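/- **Setting.** Let $\nu$ be a $\sigma$-finite reference measure on $\mathbb{R}$ (for instance Lebesgue measure, or the counting measure on $\mathbb{N}$), and let $\mu$ be a probability measure on $\mathbb{R}$ with density $m$ with respect to $\nu$. Let $\{Q_i ; i=0,1,\dots\}$ be an orthogonal basis of $L^2(\mu)$: nonzero, pairwise orthogonal functions with dense linear span. Let $Y$ and $Z$ be independent real random variables. Assume the null hypothesis $H_0$: $Y$ has the given density $f_0$ with respect to $\nu$, while $Z$ has the known density $g$ with respect to $\nu$. Assume that $Y+Z$ has a density $h$ with respect to $\nu$, that the laws of $Y$ and $Y+Z$ are dominated by $\mu$, and that $h\in L^2(\mu)$. Let $X_1,X_2,\dots$ be i.i.d. copies of $Y+Z$. For $j\ge 1$ assume that $Q_j(Y+Z)\,m(Y+Z)$ has a finite second moment. Put $\alpha_j=\mathbb{E}\big(Q_j(Y+Z)\,m(Y+Z)\big)$ and $$\hat b_j=\frac1{\sqrt n}\sum_{i=1}^n\big(Q_j(X_i)\,m(X_i)-\alpha_j\big),\qquad B_k=(\hat b_1,\dots,\hat b_k)^T,\qquad \Sigma_k=\operatorname{Var}(B_k),$$ where $\Sigma_k$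 is the $k\times k$ covariance matrix of $B_k$ (it does not depend on the sample size $n\ge1$), assumed invertible for every $k\ge 1$. Let $$T_k=\big\|\Sigma_k^{-1/2}B_k\big\|^2,$$ with the Euclidean norm. Let $k(n)$ be a nondecreasing sequence of natural numbers with $k(n)\to\infty$, and let $$S_n=\min\Big\{\operatorname*{argmax}_{1\le k\le k(n)}\big(T_k-k\log n\big)\Big\}.$$ **Proposition 2.1.** Let $\lambda_{k(n)}$ be the smallest eigenvalue of $\Sigma_{k(n)}$, and assume that $$\frac{\log k(n)}{\lambda_{k(n)}}=o(\log n)\qquad(n\to\infty).$$ Then, under $H_0$, $T_{S_n}$ converges in distribution, as $n\to\infty$, to a chi-squared random variable with $1$ degree of freedom. -/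

import Mathlib

open MeasureTheory ProbabilityTheory Filter Asymptotics

noncomputable section

namespace Deconvolution

/-- `f` is a (real, nonnegative, measurable) density of the measure `ρ` with respect to `ν`. -/
structure IsDensity (ρ ν : Measure ℝ) (f : ℝ → ℝ) : Prop where
  measurable : Measurable f
  nonneg : ∀ x, 0 ≤ f x
  eq_withDensity : ρ = ν.withDensity (fun x => ENNReal.ofReal (f x))

/-- `Q 0, Q 1, …` is an orthogonal basis of `L²(μ)`: square integrable nonzero functions,
pairwise orthogonal, whose linear span is dense in `L²(μ)`. They need not be normalized. -/
structure IsOrthogonalBasis (μ : Measure ℝ) (Q : ℕ → ℝ → ℝ) : Prop where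
  measurable : ∀ i, Measurable (Q i)
  memLp : ∀ i, MemLp (Q i) 2 μ
  orthogonal : ∀ i j, i ≠ j → ∫ x, Q i x * Q j x ∂μ = 0
  ne_zero : ∀ i, ∫ x, Q i x ^ 2 ∂μ ≠ 0
  dense : (Submodule.span ℝ
    (Set.range fun i => (memLp i).toLp (Q i))).topologicalClosure = ⊤

/-- The null coefficients `α_j = E (Q_j(Y + Z) m(Y + Z))`. -/
def nullCoeff {Ω' : Type*} [MeasurableSpace Ω'] (P' : Measure Ω') (Y Z : Ω' → ℝ)
    (Q : ℕ → ℝ → ℝ) (m : ℝ → ℝ) (j : ℕ) : ℝ :=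
  ∫ ω, Q j (Y ω + Z ω) * m (Y ω + Z ω) ∂P'

section Statistic

variable {Ω : Type*} [MeasurableSpace Ω]

/-- The centered empirical coefficient
`b̂_j = n^{-1/2} ∑_{i=1}^n (Q_j(X_i) m(X_i) - α_j)` of the sample `X 0, …, X (n - 1)`. -/
def empCoeff (Q : ℕ → ℝ → ℝ) (m : ℝ → ℝ) (α : ℕ → ℝ) (X : ℕ → Ω → ℝ) (n j : ℕ) (ω : Ω) : ℝ :=
  (1 / √(n : ℝ)) * ∑ i ∈ Finset.range n, (Q j (X i ω) * m (X i ω) - α j)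

/-- The vector `B_k = (b̂_1, …, b̂_k)` for sample size `n`; the entry with index `i : Fin k`
is `b̂_{i+1}`. -/
def coeffVec (Q : ℕ → ℝ → ℝ) (m : ℝ → ℝ) (α : ℕ → ℝ) (X : ℕ → Ω → ℝ) (n k : ℕ) (ω : Ω) :
    Fin k → ℝ :=
  fun i => empCoeff Q m α X n (i + 1) ω

/-- The covariance matrix `Σ_k = Var (B_k)` for sample size `n`. -/
def covMatrix (P : Measure Ω) (Q : ℕ → ℝ → ℝ) (m : ℝ → ℝ) (α : ℕ → ℝ) (X : ℕ → Ω → ℝ)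
    (n k : ℕ) : Matrix (Fin k) (Fin k) ℝ :=
  Matrix.of fun i j =>
    cov[fun ω => coeffVec Q m α X n k ω i, fun ω => coeffVec Q m α X n k ω j; P]

/-- The smallest eigenvalue of a real symmetric matrix: the least element of its (finite, real)
spectrum. -/
def smallestEigenvalue {k : ℕ} (A : Matrix (Fin k) (Fin k) ℝ) : ℝ :=
  sInf (spectrum ℝ A)

/-- `A^{-1/2}` for a symmetric positive definite matrix, by the spectral calculus:
`x ↦ x^{-1/2}` is applied to the eigenvalues of `A`. -/
def invSqrt {k : ℕ} (A : Matrix (Fin k) (Fin k) ℝ) : Matrix (Fin k) (Fin k) ℝ :=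
  cfc (fun x : ℝ => (√x)⁻¹) A

/-- `T_k = ‖U_k‖²` with `U_k = Σ_k^{-1/2} B_k` and the Euclidean norm, for sample size `n`. -/
def testStat (P : Measure Ω) (Q : ℕ → ℝ → ℝ) (m : ℝ → ℝ) (α : ℕ → ℝ) (X : ℕ → Ω → ℝ)
    (n k : ℕ) (ω : Ω) : ℝ :=
  ‖WithLp.toLp 2 ((invSqrt (covMatrix P Q m α X n k)).mulVec (coeffVec Q m α X n k ω))‖ ^ 2

/-- The Schwarz-type selection rule
`S_n = min argmax_{1 ≤ k ≤ K} (T_k - k log n)`, where `T` is a sequence of real numbers. -/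
def schwarzRule (T : ℕ → ℝ) (n K : ℕ) : ℕ :=
  sInf {k | k ∈ Finset.Icc 1 K ∧
    ∀ j ∈ Finset.Icc 1 K, T j - j * Real.log n ≤ T k - k * Real.log n}

/-- The data-driven statistic `T_{S_n}`, with `S_n` selected among `1, …, K n`. -/
def dataDrivenStat (P : Measure Ω) (Q : ℕ → ℝ → ℝ) (m : ℝ → ℝ) (α : ℕ → ℝ) (X : ℕ → Ω → ℝ)
    (K : ℕ → ℕ) (n : ℕ) (ω : Ω) : ℝ :=
  testStat P Q m α X n (schwarzRule (fun k => testStat P Q m α X n k ω) n (K n)) ω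

end Statistic

/-- The chi-squared distribution with `d` degrees of freedom: the law of the sum of the squares
of `d` independent standard normal variables. -/
def chiSquared (d : ℕ) : Measure ℝ :=
  (Measure.pi fun _ : Fin d => gaussianReal 0 1).map fun z => ∑ i, z i ^ 2

instance (d : ℕ) : IsProbabilityMeasure (chiSquared d) :=
  Measure.isProbabilityMeasure_map
    (Finset.measurable_sum _ fun i _ => (measurable_pi_apply i).pow_const 2).aemeasurable

end Deconvolution

end

/-!
Since `T_k = max_v (2 v·B_k - v·Σ_k v)` and `Σ_k` is a principal submatrix of `Σ_{k+1}`, the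
statistic `T_k` is nondecreasing in `k`, and `E T_k = tr (Σ_k⁻¹ Σ_k) = k`. If `S_n = s ≠ 1`, then
`T_s - T_1 ≥ (s - 1) log n`, hence `∑_{k ≤ k(n)} (T_{k+1} - T_k) / k ≥ log n`. The terms of this sum
are nonnegative with mean `1 / k`, so Markov's inequality gives
`P (S_n ≠ 1) ≤ (1 + log k(n)) / log n`. The eigenvalue condition makes this tend to zero, because
the smallest eigenvalue of `Σ_{k(n)}` is at most its `(1, 1)` entry, which does not depend on `n`.
So `T_{S_n}` has the same limit as `T_1 = b̂_1² / Var b̂_1`, which is `χ²₁` by the central limit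
theorem.
-/

namespace Deconvolution

open scoped Matrix Topology

section QuadraticForms

variable {ι κ : Type*} [Fintype ι] [DecidableEq ι] [Fintype κ] [DecidableEq κ]
  {A : Matrix ι ι ℝ}

lemma mulVec_inv_mulVec (hA : IsUnit A) (b : ι → ℝ) : A *ᵥ (A⁻¹ *ᵥ b) = b := by
  rw [Matrix.mulVec_mulVec, Matrix.mul_nonsing_inv A (A.isUnit_iff_isUnit_det.1 hA),
    Matrix.one_mulVec]

lemma two_mul_dotProduct_sub_le (hA : A.PosDef) (b v : ι → ℝ) :
    2 * (v ⬝ᵥ b) - v ⬝ᵥ (A *ᵥ v) ≤ b ⬝ᵥ (A⁻¹ *ᵥ b) := by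
  have hmul := mulVec_inv_mulVec hA.isUnit b
  have hsymm : (A⁻¹ *ᵥ b) ⬝ᵥ (A *ᵥ v) = v ⬝ᵥ b := by
    rw [Matrix.dotProduct_mulVec, ← Matrix.mulVec_transpose,
      ← Matrix.conjTranspose_eq_transpose_of_trivial, hA.isHermitian.eq, hmul, dotProduct_comm]
  have hsq : 0 ≤ (v - A⁻¹ *ᵥ b) ⬝ᵥ (A *ᵥ (v - A⁻¹ *ᵥ b)) := by
    simpa only [star_trivial] using hA.posSemidef.dotProduct_mulVec_nonneg (v - A⁻¹ *ᵥ b)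
  rw [Matrix.mulVec_sub, hmul, sub_dotProduct, dotProduct_sub, dotProduct_sub, hsymm,
    dotProduct_comm (A⁻¹ *ᵥ b) b] at hsq
  linarith

lemma dotProduct_inv_mulVec_compression_le (hA : A.PosDef) {J : Matrix ι κ ℝ}
    (hJ : IsUnit (Jᵀ * A * J)) (b : ι → ℝ) :
    (Jᵀ *ᵥ b) ⬝ᵥ ((Jᵀ * A * J)⁻¹ *ᵥ (Jᵀ *ᵥ b)) ≤ b ⬝ᵥ (A⁻¹ *ᵥ b) := by
  set c := Jᵀ *ᵥ b
  set v := (Jᵀ * A * J)⁻¹ *ᵥ c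
  have hlin : (J *ᵥ v) ⬝ᵥ b = c ⬝ᵥ v := by
    rw [dotProduct_comm, Matrix.dotProduct_mulVec, ← Matrix.mulVec_transpose]
  have hquad : (J *ᵥ v) ⬝ᵥ (A *ᵥ (J *ᵥ v)) = c ⬝ᵥ v := by
    calc (J *ᵥ v) ⬝ᵥ (A *ᵥ (J *ᵥ v)) = v ⬝ᵥ ((Jᵀ * A * J) *ᵥ v) := by
          simp only [← Matrix.mulVec_mulVec, Matrix.dotProduct_mulVec v Jᵀ, Matrix.vecMul_transpose]
      _ = v ⬝ᵥ c := by rw [mulVec_inv_mulVec hJ]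
      _ = c ⬝ᵥ v := dotProduct_comm _ _
  have hle := two_mul_dotProduct_sub_le hA b (J *ᵥ v)
  rw [hlin, hquad] at hle
  linarith

lemma dotProduct_inv_mulVec_submatrix_le (hA : A.PosDef) {f : κ → ι}
    (hf : IsUnit (A.submatrix f f)) (b : ι → ℝ) :
    (b ∘ f) ⬝ᵥ ((A.submatrix f f)⁻¹ *ᵥ (b ∘ f)) ≤ b ⬝ᵥ (A⁻¹ *ᵥ b) := by
  set J : Matrix ι κ ℝ := (1 : Matrix ι ι ℝ).submatrix id f
  have hJA : Jᵀ * A * J = A.submatrix f f := by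
    ext i j
    simp [J, Matrix.mul_apply, Matrix.one_apply]
  have hJb : Jᵀ *ᵥ b = b ∘ f := by
    ext i
    simp [J, Matrix.mulVec, dotProduct, Matrix.one_apply]
  have hle := dotProduct_inv_mulVec_compression_le (J := J) hA (by rwa [hJA]) b
  rwa [hJA, hJb] at hle

end QuadraticForms

section Spectrum

open scoped MatrixOrder

variable {k : ℕ} {A : Matrix (Fin k) (Fin k) ℝ}

lemma invSqrt_mul_invSqrt (hA : A.PosDef) : invSqrt A * invSqrt A = A⁻¹ := by
  have hfin : (spectrum ℝ A).Finite := by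
    rw [hA.isHermitian.spectrum_real_eq_range_eigenvalues]
    exact Set.finite_range _
  have hsa : IsSelfAdjoint A := hA.isHermitian
  refine (Matrix.inv_eq_left_inv ?_).symm
  calc invSqrt A * invSqrt A * A = cfc (fun x : ℝ => (√x)⁻¹ * (√x)⁻¹ * x) A := by
        rw [cfc_mul (fun x : ℝ => (√x)⁻¹ * (√x)⁻¹) (fun x => x) A (hfin.continuousOn _)
          (hfin.continuousOn _), cfc_mul (fun x : ℝ => (√x)⁻¹) _ A (hfin.continuousOn _)
          (hfin.continuousOn _), cfc_id' ℝ A hsa, invSqrt]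
    _ = cfc (fun _ : ℝ => 1) A := cfc_congr fun x hx => by
        have hx0 : 0 < x := by
          rw [hA.isHermitian.spectrum_real_eq_range_eigenvalues] at hx
          obtain ⟨i, rfl⟩ := hx
          exact hA.eigenvalues_pos i
        rw [← mul_inv, Real.mul_self_sqrt hx0.le, inv_mul_cancel₀ hx0.ne']
    _ = 1 := cfc_const_one ℝ A hsa

lemma norm_invSqrt_mulVec_sq (hA : A.PosDef) (b : Fin k → ℝ) :
    ‖WithLp.toLp 2 (invSqrt A *ᵥ b)‖ ^ 2 = b ⬝ᵥ (A⁻¹ *ᵥ b) := by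
  have hsymm : (invSqrt A)ᵀ = invSqrt A :=
    cfc_predicate (p := IsSelfAdjoint) (fun x : ℝ => (√x)⁻¹) A
  calc ‖WithLp.toLp 2 (invSqrt A *ᵥ b)‖ ^ 2 = (invSqrt A *ᵥ b) ⬝ᵥ (invSqrt A *ᵥ b) := by
        rw [EuclideanSpace.real_norm_sq_eq]
        exact Finset.sum_congr rfl fun i _ => sq _
    _ = b ⬝ᵥ (A⁻¹ *ᵥ b) := by
        rw [← invSqrt_mul_invSqrt hA, ← Matrix.mulVec_mulVec, Matrix.dotProduct_mulVec b,
          ← Matrix.mulVec_transpose, hsymm]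

lemma smallestEigenvalue_pos [NeZero k] (hA : A.PosDef) : 0 < smallestEigenvalue A := by
  rw [smallestEigenvalue, hA.isHermitian.spectrum_real_eq_range_eigenvalues]
  obtain ⟨i, hi⟩ := (Set.range_nonempty hA.isHermitian.eigenvalues).csInf_mem (Set.finite_range _)
  exact hi ▸ hA.eigenvalues_pos i

lemma smallestEigenvalue_le_diag (hA : A.IsHermitian) (i : Fin k) :
    smallestEigenvalue A ≤ A i i := by
  have hbdd : BddBelow (spectrum ℝ A) := by
    rw [hA.spectrum_real_eq_range_eigenvalues]
    exact (Set.finite_range _).bddBelow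
  have hle : algebraMap ℝ _ (smallestEigenvalue A) ≤ A :=
    (algebraMap_le_iff_le_spectrum hA).2 fun x hx => csInf_le hbdd hx
  simpa [Matrix.algebraMap_eq_diagonal] using (Matrix.le_iff.1 hle).diag_nonneg (i := i)

lemma isLittleO_of_div_smallestEigenvalue {ι : Type*} {l : Filter ι} {K : ι → ℕ}
    {A : ∀ i, Matrix (Fin (K i)) (Fin (K i)) ℝ} {C : ℝ} {f g : ι → ℝ}
    (hA : ∀ᶠ i in l, (A i).PosDef) (hC : ∀ᶠ i in l, ∃ p, A i p p ≤ C)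
    (hfg : (fun i => f i / smallestEigenvalue (A i)) =o[l] g) : f =o[l] g := by
  refine IsBigO.trans_isLittleO (IsBigO.of_bound C ?_) hfg
  filter_upwards [hA, hC] with i hAi ⟨p, hp⟩
  have : NeZero (K i) := .of_pos p.pos
  have hpos := smallestEigenvalue_pos hAi
  rw [norm_div, Real.norm_of_nonneg hpos.le, mul_div_assoc', le_div_iff₀ hpos, mul_comm]
  exact mul_le_mul_of_nonneg_right ((smallestEigenvalue_le_diag hAi.isHermitian p).trans hp)
    (norm_nonneg _)

end Spectrum

section Moments

variable {ι Ω : Type*} [MeasurableSpace Ω]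

/-- The covariance matrix of a random vector, given by its coordinates `V i`. -/
noncomputable def vecCovMatrix (P : Measure Ω) (V : ι → Ω → ℝ) : Matrix ι ι ℝ :=
  Matrix.of fun i j => cov[V i, V j; P]

variable {P : Measure Ω} {V : ι → Ω → ℝ}

lemma integrable_dotProduct_mulVec [Fintype ι] (hV : ∀ i, MemLp (V i) 2 P) (R : Matrix ι ι ℝ) :
    Integrable (fun ω => (V · ω) ⬝ᵥ (R *ᵥ (V · ω))) P :=
  integrable_finsetSum _ fun i _ =>
    (hV i).integrable_mul (memLp_finsetSum _ fun j _ => (hV j).const_mul (R i j))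

variable [IsProbabilityMeasure P]

lemma dotProduct_vecCovMatrix_mulVec [Fintype ι] (hV : ∀ i, MemLp (V i) 2 P) (x : ι → ℝ) :
    x ⬝ᵥ (vecCovMatrix P V *ᵥ x) = Var[fun ω => ∑ i, x i * V i ω; P] := by
  have hxV (i : ι) : MemLp (fun ω => x i * V i ω) 2 P := (hV i).const_mul (x i)
  rw [← covariance_self (memLp_finsetSum _ fun i _ => hxV i).aestronglyMeasurable.aemeasurable,
    covariance_fun_sum_fun_sum hxV hxV]
  simp only [covariance_const_mul_left, covariance_const_mul_right, dotProduct, Matrix.mulVec,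
    vecCovMatrix, Matrix.of_apply, Finset.mul_sum]
  exact Finset.sum_congr rfl fun i _ => Finset.sum_congr rfl fun j _ => by ring

lemma posSemidef_vecCovMatrix [Finite ι] (hV : ∀ i, MemLp (V i) 2 P) :
    (vecCovMatrix P V).PosSemidef := by
  have := Fintype.ofFinite ι
  refine Matrix.PosSemidef.of_dotProduct_mulVec_nonneg
    (Matrix.ext fun i j => covariance_comm _ _) fun x => ?_
  rw [star_trivial, dotProduct_vecCovMatrix_mulVec hV]
  exact variance_nonneg _ _

lemma integral_dotProduct_mulVec [Fintype ι] (hV : ∀ i, MemLp (V i) 2 P)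
    (hV0 : ∀ i, ∫ ω, V i ω ∂P = 0) (R : Matrix ι ι ℝ) :
    ∫ ω, (V · ω) ⬝ᵥ (R *ᵥ (V · ω)) ∂P = (R * vecCovMatrix P V).trace := by
  have hcov (i j : ι) : ∫ ω, V i ω * V j ω ∂P = vecCovMatrix P V i j := by
    simp [vecCovMatrix, covariance_eq_sub (hV i) (hV j), hV0]
  have hint (i j : ι) : Integrable (fun ω => R i j * (V j ω * V i ω)) P :=
    ((hV j).integrable_mul (hV i)).const_mul _
  calc ∫ ω, (V · ω) ⬝ᵥ (R *ᵥ (V · ω)) ∂P = ∫ ω, ∑ i, ∑ j, R i j * (V j ω * V i ω) ∂P := by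
        congr! 2 with ω
        simp only [dotProduct, Matrix.mulVec, Finset.mul_sum]
        exact Finset.sum_congr rfl fun i _ => Finset.sum_congr rfl fun j _ => by ring
    _ = ∑ i, ∑ j, R i j * vecCovMatrix P V j i := by
        rw [integral_finsetSum _ fun i _ => integrable_finsetSum _ fun j _ => hint i j]
        simp only [integral_finsetSum _ fun j _ => hint _ j, integral_const_mul, hcov]

lemma integral_dotProduct_inv_vecCovMatrix_mulVec [Fintype ι] [DecidableEq ι]
    (hV : ∀ i, MemLp (V i) 2 P) (hV0 : ∀ i, ∫ ω, V i ω ∂P = 0) (hC : IsUnit (vecCovMatrix P V)) :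
    ∫ ω, (V · ω) ⬝ᵥ ((vecCovMatrix P V)⁻¹ *ᵥ (V · ω)) ∂P = Fintype.card ι := by
  rw [integral_dotProduct_mulVec hV hV0,
    Matrix.nonsing_inv_mul _ ((Matrix.isUnit_iff_isUnit_det _).1 hC), Matrix.trace_one]

end Moments

section Selection

lemma schwarzRule_mem {T : ℕ → ℝ} {n N : ℕ} (hN : 1 ≤ N) :
    schwarzRule T n N ∈ Finset.Icc 1 N ∧ ∀ j ∈ Finset.Icc 1 N,
      T j - j * Real.log n ≤ T (schwarzRule T n N) - schwarzRule T n N * Real.log n := by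
  obtain ⟨k, hk, hmax⟩ := (Finset.Icc 1 N).exists_max_image (fun j => T j - j * Real.log n)
    ⟨1, Finset.left_mem_Icc.2 hN⟩
  exact Nat.sInf_mem (s := {k | k ∈ Finset.Icc 1 N ∧
    ∀ j ∈ Finset.Icc 1 N, T j - j * Real.log n ≤ T k - k * Real.log n}) ⟨k, hk, hmax⟩

lemma measurable_schwarzRule (n N : ℕ) : Measurable fun T : ℕ → ℝ => schwarzRule T n N := by
  classical
  rcases Nat.eq_zero_or_pos N with rfl | hN
  · simp [schwarzRule]
  let IsArgmax (T : ℕ → ℝ) (k : ℕ) : Prop := k ∈ Finset.Icc 1 N ∧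
    ∀ j ∈ Finset.Icc 1 N, T j - j * Real.log n ≤ T k - k * Real.log n
  have hex (T : ℕ → ℝ) : ∃ k, IsArgmax T k := ⟨_, schwarzRule_mem hN⟩
  have hfind : (fun T => schwarzRule T n N) = fun T => Nat.find (hex T) := by
    funext T
    exact (Nat.sInf_def (hex T)).trans (by congr!)
  rw [hfind]
  exact measurable_find hex fun k => Measurable.setOf <| measurable_const.and <| .forall fun j =>
    measurable_const.imp <| measurableSet_setOfPred.1 <|
      measurableSet_le (by fun_prop) (by fun_prop)

lemma measurable_apply_schwarzRule (n N : ℕ) :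
    Measurable fun T : ℕ → ℝ => T (schwarzRule T n N) :=
  (measurable_from_prod_countable_right (f := fun p : ℕ × (ℕ → ℝ) => p.2 p.1)
    measurable_pi_apply).comp ((measurable_schwarzRule n N).prodMk measurable_id)

lemma log_le_sum_of_schwarzRule_ne_one {T : ℕ → ℝ} {n N : ℕ} (hN : 1 ≤ N)
    (hT : ∀ k, 1 ≤ k → T k ≤ T (k + 1)) (hS : schwarzRule T n N ≠ 1) :
    Real.log n ≤ ∑ k ∈ Finset.Icc 1 N, (T (k + 1) - T k) / k := by
  obtain ⟨hmem, hmax⟩ := schwarzRule_mem (T := T) (n := n) hN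
  have hpenalty := hmax 1 (Finset.left_mem_Icc.2 hN)
  generalize schwarzRule T n N = s at *
  obtain ⟨hs1, hsN⟩ := Finset.mem_Icc.1 hmem
  have hs : (1 : ℝ) < s := mod_cast lt_of_le_of_ne hs1 (Ne.symm hS)
  have hterm (k : ℕ) (hk : 1 ≤ k) : 0 ≤ (T (k + 1) - T k) / k :=
    div_nonneg (sub_nonneg.2 (hT k hk)) k.cast_nonneg
  refine le_of_mul_le_mul_left (a := (s : ℝ) - 1) ?_ (sub_pos.2 hs)
  calc (s - 1) * Real.log n ≤ T s - T 1 := by push_cast at hpenalty; linarith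
    _ = ∑ k ∈ Finset.Ico 1 s, (T (k + 1) - T k) := (Finset.sum_Ico_sub T hs1).symm
    _ ≤ ∑ k ∈ Finset.Ico 1 s, (s - 1) * ((T (k + 1) - T k) / k) := by
        refine Finset.sum_le_sum fun k hk => ?_
        obtain ⟨hk1, hks⟩ := Finset.mem_Ico.1 hk
        have hks' : (k : ℝ) ≤ s - 1 := by
          rw [le_sub_iff_add_le]
          exact_mod_cast hks
        calc T (k + 1) - T k = k * ((T (k + 1) - T k) / k) :=
              (mul_div_cancel₀ _ (Nat.cast_ne_zero.2 (by lia))).symm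
          _ ≤ _ := mul_le_mul_of_nonneg_right hks' (hterm k hk1)
    _ = (s - 1) * ∑ k ∈ Finset.Ico 1 s, (T (k + 1) - T k) / k := (Finset.mul_sum ..).symm
    _ ≤ (s - 1) * ∑ k ∈ Finset.Icc 1 N, (T (k + 1) - T k) / k := by
        refine mul_le_mul_of_nonneg_left ?_ (sub_pos.2 hs).le
        refine Finset.sum_le_sum_of_subset_of_nonneg (fun k hk => ?_)
          fun k hk _ => hterm k (Finset.mem_Icc.1 hk).1
        obtain ⟨hk1, hks⟩ := Finset.mem_Ico.1 hk
        exact Finset.mem_Icc.2 ⟨hk1, hks.le.trans hsN⟩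

lemma sum_Icc_inv_le_one_add_log (N : ℕ) :
    ∑ k ∈ Finset.Icc 1 N, (k : ℝ)⁻¹ ≤ 1 + Real.log N := by
  simpa only [harmonic_eq_sum_Icc, Rat.cast_sum, Rat.cast_inv, Rat.cast_natCast]
    using harmonic_le_one_add_log N

variable {Ω : Type*} [MeasurableSpace Ω] {P : Measure Ω}

lemma measureReal_schwarzRule_ne_one_le [IsFiniteMeasure P] {T : ℕ → Ω → ℝ}
    (hint : ∀ k, 1 ≤ k → Integrable (T k) P) (hmono : ∀ k, 1 ≤ k → T k ≤ T (k + 1))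
    (hstep : ∀ k, 1 ≤ k → ∫ ω, T (k + 1) ω ∂P ≤ ∫ ω, T k ω ∂P + 1) {n N : ℕ} (hn : 2 ≤ n)
    (hN : 1 ≤ N) :
    P.real {ω | schwarzRule (T · ω) n N ≠ 1} ≤ (1 + Real.log N) / Real.log n := by
  set D : Ω → ℝ := fun ω => ∑ k ∈ Finset.Icc 1 N, (T (k + 1) ω - T k ω) / k
  have hincr (k : ℕ) (hk : k ∈ Finset.Icc 1 N) :
      Integrable (fun ω => (T (k + 1) ω - T k ω) / k) P := by
    have hk1 := (Finset.mem_Icc.1 hk).1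
    exact ((hint (k + 1) (by lia)).sub (hint k hk1)).div_const _
  have hD0 (ω : Ω) : 0 ≤ D ω := Finset.sum_nonneg fun k hk =>
    div_nonneg (sub_nonneg.2 (hmono k (Finset.mem_Icc.1 hk).1 ω)) k.cast_nonneg
  have hDint : ∫ ω, D ω ∂P ≤ 1 + Real.log N := by
    rw [integral_finsetSum _ hincr]
    refine (Finset.sum_le_sum fun k hk => ?_).trans (sum_Icc_inv_le_one_add_log N)
    have hk1 := (Finset.mem_Icc.1 hk).1
    rw [integral_div, integral_sub (hint (k + 1) (by lia)) (hint k hk1), ← one_div]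
    exact div_le_div_of_nonneg_right (by linarith [hstep k hk1]) k.cast_nonneg
  rw [le_div_iff₀' (Real.log_pos (mod_cast hn))]
  calc Real.log n * P.real {ω | schwarzRule (T · ω) n N ≠ 1}
      ≤ Real.log n * P.real {ω | Real.log n ≤ D ω} :=
        mul_le_mul_of_nonneg_left (measureReal_mono fun ω hω =>
          log_le_sum_of_schwarzRule_ne_one hN (hmono · · ω) hω) (Real.log_natCast_nonneg n)
    _ ≤ ∫ ω, D ω ∂P := mul_meas_ge_le_integral_of_nonneg (.of_forall hD0)
        (integrable_finsetSum _ hincr) _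
    _ ≤ 1 + Real.log N := hDint

lemma tendsto_one_add_log_div_log {K : ℕ → ℕ}
    (hlog : (fun n : ℕ => Real.log (K n)) =o[atTop] fun n : ℕ => Real.log n) :
    Tendsto (fun n : ℕ => (1 + Real.log (K n)) / Real.log n) atTop (𝓝 0) :=
  (((Real.isLittleO_const_log_atTop (c := 1)).comp_tendsto
    tendsto_natCast_atTop_atTop).add hlog).tendsto_div_nhds_zero

lemma tendsto_measure_schwarzRule_ne_one [IsFiniteMeasure P] {T : ℕ → ℕ → Ω → ℝ}
    (hint : ∀ n k, 1 ≤ n → 1 ≤ k → Integrable (T n k) P)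
    (hmono : ∀ n k, 1 ≤ n → 1 ≤ k → T n k ≤ T n (k + 1))
    (hstep : ∀ n k, 1 ≤ n → 1 ≤ k → ∫ ω, T n (k + 1) ω ∂P ≤ ∫ ω, T n k ω ∂P + 1)
    {K : ℕ → ℕ} (hK : ∀ᶠ n in atTop, 1 ≤ K n)
    (hlog : (fun n : ℕ => Real.log (K n)) =o[atTop] fun n : ℕ => Real.log n) :
    Tendsto (fun n => P {ω | schwarzRule (T n · ω) n (K n) ≠ 1}) atTop (𝓝 0) := by
  rw [← ENNReal.tendsto_toReal_iff (fun _ => measure_ne_top _ _) ENNReal.zero_ne_top]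
  refine squeeze_zero' (.of_forall fun _ => ENNReal.toReal_nonneg) ?_
    (tendsto_one_add_log_div_log hlog)
  filter_upwards [eventually_ge_atTop 2, hK] with n hn hKn
  have hn1 : 1 ≤ n := one_le_two.trans hn
  exact measureReal_schwarzRule_ne_one_le (hint n · hn1) (hmono n · hn1) (hstep n · hn1) hn hKn

end Selection

section Limits

lemma tendstoInDistribution_of_tendsto_measure_ne {ι E Ω Ω' : Type*} [MeasurableSpace Ω]
    {P : Measure Ω} [IsProbabilityMeasure P] [MeasurableSpace Ω'] {P' : Measure Ω'}
    [IsProbabilityMeasure P'] [NormedAddCommGroup E] [MeasurableSpace E] [BorelSpace E]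
    [SecondCountableTopology E] {l : Filter ι}
    [l.IsCountablyGenerated] {X Y : ι → Ω → E} {Z : Ω' → E}
    (hX : TendstoInDistribution X l Z (fun _ => P) P') (hY : ∀ i, AEMeasurable (Y i) P)
    (hne : Tendsto (fun i => P {ω | Y i ω ≠ X i ω}) l (𝓝 0)) :
    TendstoInDistribution Y l Z (fun _ => P) P' := by
  refine tendstoInDistribution_of_tendstoInMeasure_sub Y Z hX (fun ε hε => ?_) hY
  refine tendsto_of_tendsto_of_tendsto_of_le_of_le tendsto_const_nhds hne (fun _ => zero_le)
    fun i => measure_mono fun ω hω heq => hε.ne' ?_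
  simpa [heq] using hω

lemma tendstoInDistribution_of_identDistrib_limit {ι E Ω' Ω'' : Type*} {Ω : ι → Type*}
    [∀ i, MeasurableSpace (Ω i)] {μ : ∀ i, Measure (Ω i)} [∀ i, IsProbabilityMeasure (μ i)]
    [MeasurableSpace Ω'] {μ' : Measure Ω'} [IsProbabilityMeasure μ']
    [MeasurableSpace Ω''] {μ'' : Measure Ω''} [IsProbabilityMeasure μ'']
    [TopologicalSpace E] [MeasurableSpace E] [OpensMeasurableSpace E] {l : Filter ι}
    {X : ∀ i, Ω i → E} {Z : Ω' → E} {Z' : Ω'' → E} (hX : TendstoInDistribution X l Z μ μ')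
    (hZ : IdentDistrib Z Z' μ' μ'') : TendstoInDistribution X l Z' μ μ'' where
  forall_aemeasurable := hX.forall_aemeasurable
  aemeasurable_limit := hZ.aemeasurable_snd
  tendsto := by
    convert! hX.tendsto using 2
    exact congrArg 𝓝 (Subtype.ext hZ.map_eq.symm)

lemma map_sq_gaussianReal : (gaussianReal 0 1).map (fun x => x ^ 2) = chiSquared 1 := by
  rw [← (measurePreserving_eval (fun _ : Fin 1 => gaussianReal 0 1) 0).map_eq,
    Measure.map_map (by fun_prop) (by fun_prop), chiSquared]
  congr 1
  funext z
  simp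

end Limits

section Sample

/-- The function `Q_j m`, whose values at the observations are averaged in `b̂_j`. -/
def score (Q : ℕ → ℝ → ℝ) (m : ℝ → ℝ) (j : ℕ) (x : ℝ) : ℝ :=
  Q j x * m x

variable {Ω Ω' : Type*} [MeasurableSpace Ω] [MeasurableSpace Ω'] {P : Measure Ω}
  {P' : Measure Ω'} {W : Ω' → ℝ} {Q : ℕ → ℝ → ℝ} {m : ℝ → ℝ} {α : ℕ → ℝ} {X : ℕ → Ω → ℝ}
  {n k j : ℕ}

lemma aemeasurable_empCoeff (hscore : Measurable (score Q m j)) (hX : ∀ i, AEMeasurable (X i) P)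
    (n : ℕ) : AEMeasurable (empCoeff Q m α X n j) P :=
  (Finset.aemeasurable_fun_sum _ fun i _ =>
    (hscore.comp_aemeasurable (hX i)).sub_const _).const_mul _

lemma aemeasurable_testStat (hscore : ∀ j, Measurable (score Q m j))
    (hX : ∀ i, AEMeasurable (X i) P) (n k : ℕ) : AEMeasurable (testStat P Q m α X n k) P := by
  have hcont (R : Matrix (Fin k) (Fin k) ℝ) :
      Continuous fun b : Fin k → ℝ => ‖WithLp.toLp 2 (R *ᵥ b)‖ ^ 2 := by fun_prop
  exact (hcont (invSqrt (covMatrix P Q m α X n k))).measurable.comp_aemeasurable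
    (aemeasurable_pi_lambda _ fun i => aemeasurable_empCoeff (hscore (i + 1)) hX n)

lemma aemeasurable_dataDrivenStat (hscore : ∀ j, Measurable (score Q m j))
    (hX : ∀ i, AEMeasurable (X i) P) (K : ℕ → ℕ) (n : ℕ) :
    AEMeasurable (dataDrivenStat P Q m α X K n) P :=
  (measurable_apply_schwarzRule n (K n)).comp_aemeasurable
    (aemeasurable_pi_lambda _ fun k => aemeasurable_testStat hscore hX n k)

lemma testStat_eq (hC : (covMatrix P Q m α X n k).PosDef) (ω : Ω) :
    testStat P Q m α X n k ω = coeffVec Q m α X n k ω ⬝ᵥ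
      ((covMatrix P Q m α X n k)⁻¹ *ᵥ coeffVec Q m α X n k ω) :=
  norm_invSqrt_mulVec_sq hC _

lemma testStat_one_eq (hC : (covMatrix P Q m α X n 1).PosDef) (ω : Ω) :
    testStat P Q m α X n 1 ω = empCoeff Q m α X n 1 ω ^ 2 / covMatrix P Q m α X n 1 0 0 := by
  rw [testStat_eq hC, Matrix.inv_subsingleton]
  simp [coeffVec, Matrix.mulVec, dotProduct, sq, div_eq_mul_inv, mul_assoc, mul_comm]

lemma testStat_le_testStat_succ (hC : (covMatrix P Q m α X n k).PosDef)
    (hC' : (covMatrix P Q m α X n (k + 1)).PosDef) :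
    testStat P Q m α X n k ≤ testStat P Q m α X n (k + 1) := fun ω => by
  rw [testStat_eq hC, testStat_eq hC']
  exact dotProduct_inv_mulVec_submatrix_le (f := Fin.castSucc) hC' hC.isUnit
    (coeffVec Q m α X n (k + 1) ω)

variable [IsProbabilityMeasure P]

lemma memLp_empCoeff (hident : ∀ i, IdentDistrib (X i) W P P') (hscore : Measurable (score Q m j))
    (hL2 : MemLp (score Q m j ∘ W) 2 P') (n : ℕ) :
    MemLp (empCoeff Q m α X n j) 2 P :=
  (memLp_finsetSum _ fun i _ =>
    (((hident i).comp hscore).memLp_iff.2 hL2).sub (memLp_const _)).const_mul _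

lemma integral_empCoeff (hident : ∀ i, IdentDistrib (X i) W P P')
    (hscore : Measurable (score Q m j)) (hL2 : MemLp (score Q m j ∘ W) 2 P')
    (hα : α j = ∫ ω, score Q m j (W ω) ∂P') (n : ℕ) :
    ∫ ω, empCoeff Q m α X n j ω ∂P = 0 := by
  have hint (i : ℕ) : Integrable (fun ω => score Q m j (X i ω)) P :=
    (((hident i).comp hscore).memLp_iff.2 hL2).integrable one_le_two
  have hmean (i : ℕ) : ∫ ω, score Q m j (X i ω) ∂P = α j :=
    ((hident i).comp hscore).integral_eq.trans hα.symm
  calc ∫ ω, empCoeff Q m α X n j ω ∂P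
      = 1 / √n * ∫ ω, ∑ i ∈ Finset.range n, (score Q m j (X i ω) - α j) ∂P :=
        integral_const_mul _ _
    _ = 1 / √n * ∑ i ∈ Finset.range n, (∫ ω, score Q m j (X i ω) ∂P - α j) := by
        rw [integral_finsetSum (f := fun i ω => score Q m j (X i ω) - α j) _
          fun i _ => (hint i).sub (integrable_const _)]
        simp [integral_sub (hint _) (integrable_const _)]
    _ = 0 := by simp [hmean]

lemma variance_empCoeff (hindep : iIndepFun X P) (hident : ∀ i, IdentDistrib (X i) W P P')
    (hscore : Measurable (score Q m j)) (hL2 : MemLp (score Q m j ∘ W) 2 P')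
    (hn : 1 ≤ n) :
    Var[empCoeff Q m α X n j; P] = Var[score Q m j ∘ W; P'] := by
  have hLp (i : ℕ) : MemLp (fun ω => score Q m j (X i ω)) 2 P :=
    ((hident i).comp hscore).memLp_iff.2 hL2
  have hvar (i : ℕ) : Var[fun ω => score Q m j (X i ω) - α j; P] =
      Var[score Q m j ∘ W; P'] := by
    rw [variance_sub_const (hLp i).aestronglyMeasurable]
    exact ((hident i).comp hscore).variance_eq
  have hsum : Var[fun ω => ∑ i ∈ Finset.range n, (score Q m j (X i ω) - α j); P] =
      n * Var[score Q m j ∘ W; P'] := by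
    rw [← Finset.sum_fn, IndepFun.variance_sum (X := fun i ω => score Q m j (X i ω) - α j)
      (fun i _ => (hLp i).sub (memLp_const _)) fun i _ l _ hil =>
        (hindep.indepFun hil).comp (hscore.sub_const _) (hscore.sub_const _)]
    simp [hvar]
  have hn0 : (n : ℝ) ≠ 0 := Nat.cast_ne_zero.2 (by lia)
  calc Var[empCoeff Q m α X n j; P]
      = (1 / √n) ^ 2 * Var[fun ω => ∑ i ∈ Finset.range n, (score Q m j (X i ω) - α j); P] :=
        variance_const_mul _ _ _
    _ = Var[score Q m j ∘ W; P'] := by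
        rw [hsum, div_pow, Real.sq_sqrt n.cast_nonneg]
        field_simp

lemma covMatrix_diag (hindep : iIndepFun X P) (hident : ∀ i, IdentDistrib (X i) W P P')
    (i : Fin k) (hscore : Measurable (score Q m (i + 1)))
    (hL2 : MemLp (score Q m (i + 1) ∘ W) 2 P') (hn : 1 ≤ n) :
    covMatrix P Q m α X n k i i = Var[score Q m (i + 1) ∘ W; P'] :=
  (covariance_self (memLp_empCoeff hident hscore hL2 n).aestronglyMeasurable.aemeasurable).trans
    (variance_empCoeff hindep hident hscore hL2 hn)

lemma posDef_covMatrix (hident : ∀ i, IdentDistrib (X i) W P P')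
    (hscore : ∀ j, Measurable (score Q m j))
    (hL2 : ∀ j, 1 ≤ j → MemLp (score Q m j ∘ W) 2 P')
    (hC : IsUnit (covMatrix P Q m α X n k)) : (covMatrix P Q m α X n k).PosDef :=
  (posSemidef_vecCovMatrix fun i : Fin k => memLp_empCoeff hident (hscore (i + 1))
    (hL2 _ (Nat.le_add_left 1 i)) n).posDef_iff_isUnit.2 hC

lemma integrable_testStat (hident : ∀ i, IdentDistrib (X i) W P P')
    (hscore : ∀ j, Measurable (score Q m j))
    (hL2 : ∀ j, 1 ≤ j → MemLp (score Q m j ∘ W) 2 P')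
    (hC : (covMatrix P Q m α X n k).PosDef) : Integrable (testStat P Q m α X n k) P := by
  rw [funext (testStat_eq hC)]
  exact integrable_dotProduct_mulVec (fun i : Fin k => memLp_empCoeff hident (hscore (i + 1))
    (hL2 _ (Nat.le_add_left 1 i)) n) _

lemma integral_testStat (hident : ∀ i, IdentDistrib (X i) W P P')
    (hscore : ∀ j, Measurable (score Q m j))
    (hL2 : ∀ j, 1 ≤ j → MemLp (score Q m j ∘ W) 2 P')
    (hα : ∀ j, 1 ≤ j → α j = ∫ ω, score Q m j (W ω) ∂P')
    (hC : (covMatrix P Q m α X n k).PosDef) : ∫ ω, testStat P Q m α X n k ω ∂P = k := by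
  simp only [testStat_eq hC]
  have hpos (i : Fin k) : 1 ≤ (i : ℕ) + 1 := Nat.le_add_left 1 i
  refine (integral_dotProduct_inv_vecCovMatrix_mulVec
    (fun i : Fin k => memLp_empCoeff hident (hscore (i + 1)) (hL2 _ (hpos i)) n)
    (fun i => integral_empCoeff hident (hscore _) (hL2 _ (hpos i)) (hα _ (hpos i)) n)
    hC.isUnit).trans ?_
  rw [Fintype.card_fin]

lemma isLittleO_log_of_div_smallestEigenvalue (hindep : iIndepFun X P)
    (hident : ∀ i, IdentDistrib (X i) W P P') (hscore : ∀ j, Measurable (score Q m j))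
    (hL2 : ∀ j, 1 ≤ j → MemLp (score Q m j ∘ W) 2 P')
    (hinv : ∀ n k, 1 ≤ n → 1 ≤ k → IsUnit (covMatrix P Q m α X n k))
    {K : ℕ → ℕ} (hK : Tendsto K atTop atTop)
    (hlam : (fun n : ℕ => Real.log (K n) / smallestEigenvalue (covMatrix P Q m α X n (K n)))
      =o[atTop] fun n : ℕ => Real.log n) :
    (fun n : ℕ => Real.log (K n)) =o[atTop] fun n : ℕ => Real.log n := by
  refine isLittleO_of_div_smallestEigenvalue (C := Var[score Q m 1 ∘ W; P']) ?_ ?_ hlam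
  all_goals filter_upwards [eventually_ge_atTop 1, hK.eventually_ge_atTop 1] with n hn hKn
  · exact posDef_covMatrix hident hscore hL2 (hinv n (K n) hn hKn)
  · exact ⟨⟨0, hKn⟩, (covMatrix_diag hindep hident ⟨0, hKn⟩ (hscore 1) (hL2 1 le_rfl) hn).le⟩

lemma tendstoInDistribution_empCoeff (hindep : iIndepFun X P)
    (hident : ∀ i, IdentDistrib (X i) W P P') (hscore : Measurable (score Q m j))
    (hL2 : MemLp (score Q m j ∘ W) 2 P')
    (hα : α j = ∫ ω, score Q m j (W ω) ∂P') :
    TendstoInDistribution (fun n => empCoeff Q m α X n j) atTop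
      (fun x => √Var[score Q m j ∘ W; P'] * x) (fun _ => P) (gaussianReal 0 1) := by
  have hid (i : ℕ) := (hident i).comp hscore
  have hlaw : HasLaw (fun x => √Var[score Q m j ∘ W; P'] * x)
      (gaussianReal 0 Var[score Q m j ∘ X 0; P].toNNReal) (gaussianReal 0 1) := by
    convert! gaussianReal_const_mul (P := gaussianReal 0 1) HasLaw.id _ using 2
    · simp
    · rw [(hid 0).variance_eq, mul_one]
      exact NNReal.eq ((Real.coe_toNNReal _ (variance_nonneg _ _)).trans
        (Real.sq_sqrt (variance_nonneg _ _)).symm)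
  have hclt := tendstoInDistribution_inv_sqrt_mul_sum_sub
    (X := fun i => score Q m j ∘ X i) hlaw ((hid 0).memLp_iff.2 hL2)
    (hindep.comp _ fun _ => hscore) fun i => (hid i).trans (hid 0).symm
  convert! hclt using 3 with n ω
  rw [(hid 0).integral_eq]
  simp [empCoeff, score, hα, Finset.sum_sub_distrib]

lemma tendstoInDistribution_empCoeff_sq_div (hindep : iIndepFun X P)
    (hident : ∀ i, IdentDistrib (X i) W P P') (hscore : Measurable (score Q m j))
    (hL2 : MemLp (score Q m j ∘ W) 2 P')
    (hα : α j = ∫ ω, score Q m j (W ω) ∂P')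
    (hv : 0 < Var[score Q m j ∘ W; P']) :
    TendstoInDistribution
      (fun n ω => empCoeff Q m α X n j ω ^ 2 / Var[score Q m j ∘ W; P']) atTop
      (id : ℝ → ℝ) (fun _ => P) (chiSquared 1) := by
  have hsq := (tendstoInDistribution_empCoeff hindep hident hscore hL2 hα).continuous_comp
    (g := fun x => x ^ 2 / Var[score Q m j ∘ W; P']) (by fun_prop)
  refine tendstoInDistribution_of_identDistrib_limit hsq
    ⟨by fun_prop, aemeasurable_id, ?_⟩
  rw [Measure.map_id, ← map_sq_gaussianReal]
  congr 1
  funext x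
  rw [Function.comp_apply, mul_pow, Real.sq_sqrt hv.le, mul_div_cancel_left₀ _ hv.ne']

end Sample

end Deconvolution

open Deconvolution in
theorem proposition2p1_general {Ω Ω' : Type*} [MeasurableSpace Ω] [MeasurableSpace Ω']
    {P : Measure Ω} [IsProbabilityMeasure P] {P' : Measure Ω'} {W : Ω' → ℝ} {X : ℕ → Ω → ℝ}
    {Q : ℕ → ℝ → ℝ} {m : ℝ → ℝ} {α : ℕ → ℝ} {K : ℕ → ℕ}
    (hindep : iIndepFun X P) (hident : ∀ i, IdentDistrib (X i) W P P')
    (hscore : ∀ j, Measurable (score Q m j))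
    (hL2 : ∀ j, 1 ≤ j → MemLp (score Q m j ∘ W) 2 P')
    (hα : ∀ j, 1 ≤ j → α j = ∫ ω, score Q m j (W ω) ∂P')
    (hinv : ∀ n k, 1 ≤ n → 1 ≤ k → IsUnit (covMatrix P Q m α X n k))
    (hK : ∀ᶠ n in atTop, 1 ≤ K n)
    (hlog : (fun n : ℕ => Real.log (K n)) =o[atTop] fun n : ℕ => Real.log n) :
    TendstoInDistribution (fun n => dataDrivenStat P Q m α X K n) atTop
      (id : ℝ → ℝ) (fun _ => P) (chiSquared 1) := by
  have hC (n k : ℕ) (hn : 1 ≤ n) (hk : 1 ≤ k) : (covMatrix P Q m α X n k).PosDef :=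
    posDef_covMatrix hident hscore hL2 (hinv n k hn hk)
  have hvar (n : ℕ) (hn : 1 ≤ n) : covMatrix P Q m α X n 1 0 0 = _ :=
    covMatrix_diag hindep hident 0 (hscore 1) (hL2 1 le_rfl) hn
  have hselect := tendsto_measure_schwarzRule_ne_one (T := testStat P Q m α X)
    (fun n k hn hk => integrable_testStat hident hscore hL2 (hC n k hn hk))
    (fun n k hn hk => testStat_le_testStat_succ (hC n k hn hk) (hC n (k + 1) hn (by lia)))
    (fun n k hn hk => by
      rw [integral_testStat hident hscore hL2 hα (hC n k hn hk),
        integral_testStat hident hscore hL2 hα (hC n (k + 1) hn (by lia)), Nat.cast_succ]) hK hlog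
  refine tendstoInDistribution_of_tendsto_measure_ne
    (tendstoInDistribution_empCoeff_sq_div hindep hident (hscore 1) (hL2 1 le_rfl) (hα 1 le_rfl)
      (hvar 1 le_rfl ▸ (hC 1 1 le_rfl le_rfl).diag_pos))
    (aemeasurable_dataDrivenStat hscore (fun i => (hident i).aemeasurable_fst) K) ?_
  refine tendsto_of_tendsto_of_tendsto_of_le_of_le' tendsto_const_nhds hselect
    (.of_forall fun _ => zero_le) ?_
  filter_upwards [eventually_ge_atTop 1] with n hn
  refine measure_mono fun ω hne hS => hne ?_
  rw [dataDrivenStat, hS, testStat_one_eq (hC n 1 hn le_rfl), hvar n hn]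
  rfl

theorem proposition2p1
    -- the reference measure (e.g. Lebesgue or counting measure) and the probability measure `μ`,
    -- which has density `m` with respect to it
    (ν : Measure ℝ) [SigmaFinite ν]
    (μ : Measure ℝ) [IsProbabilityMeasure μ] (m : ℝ → ℝ)
    (hm : Deconvolution.IsDensity μ ν m)
    (Q : ℕ → ℝ → ℝ) (hQ : Deconvolution.IsOrthogonalBasis μ Q)
    -- under `H₀`: independent `Y ~ f₀` and `Z ~ g`, and `Y + Z` has density `h` in `L²(μ)`
    {Ω' : Type*} [MeasurableSpace Ω'] (P' : Measure Ω') [IsProbabilityMeasure P']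
    (Y Z : Ω' → ℝ) (hY : Measurable Y) (hZ : Measurable Z) (hYZ : IndepFun Y Z P')
    (f₀ g h : ℝ → ℝ)
    (hf₀ : Deconvolution.IsDensity (P'.map Y) ν f₀)
    (hg : Deconvolution.IsDensity (P'.map Z) ν g)
    (hh : Deconvolution.IsDensity (P'.map (fun ω => Y ω + Z ω)) ν h)
    (hYμ : P'.map Y ≪ μ) (hXμ : P'.map (fun ω => Y ω + Z ω) ≪ μ)
    (hhL2 : MemLp h 2 μ)
    -- the covariance matrices exist
    (hL2 : ∀ j, 1 ≤ j → MemLp (fun ω => Q j (Y ω + Z ω) * m (Y ω + Z ω)) 2 P')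
    -- the observations: i.i.d. copies of `Y + Z`
    {Ω : Type*} [MeasurableSpace Ω] (P : Measure Ω) [IsProbabilityMeasure P]
    (X : ℕ → Ω → ℝ) (hXindep : iIndepFun X P)
    (hXident : ∀ i, IdentDistrib (X i) (fun ω => Y ω + Z ω) P P')
    (α : ℕ → ℝ) (hα : α = Deconvolution.nullCoeff P' Y Z Q m)
    -- the covariance matrices are invertible
    (hinv : ∀ n k, 1 ≤ n → 1 ≤ k → IsUnit (Deconvolution.covMatrix P Q m α X n k))
    (K : ℕ → ℕ) (hKmono : Monotone K) (hK : Tendsto K atTop atTop)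
    (hlam : (fun n : ℕ => Real.log (K n) /
        Deconvolution.smallestEigenvalue (Deconvolution.covMatrix P Q m α X n (K n)))
      =o[atTop] fun n : ℕ => Real.log n) :
    TendstoInDistribution (fun n => Deconvolution.dataDrivenStat P Q m α X K n) atTop
      (id : ℝ → ℝ) (fun _ => P) (Deconvolution.chiSquared 1) := by
  have hscore (j : ℕ) : Measurable (Deconvolution.score Q m j) :=
    (hQ.measurable j).mul hm.measurable
  exact proposition2p1_general hXindep hXident hscore hL2 (fun j _ => congrFun hα j) hinv
    (hK.eventually_ge_atTop 1) (Deconvolution.isLittleO_log_of_div_smallestEigenvalue hXindep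
      hXident hscore hL2 hinv hK hlam)
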